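/- There is a universal constant $\kappa>0$ such that the following holds. Let $t,s\ge 1$ and $m,n\ge 0$ be integers, $n_s:=\lceil n/s\rceil$, and let $A^i,B^i\in\mathbb{C}^{m\times n}$ and $v^i\in\mathbb{C}^n$, $i\in[t]=\{0,\dots,t-1\}$, be fixed. Split $v^i=(v^i_0,\dots,v^i_{n_s-1})$ and $A^i=[A^i_0,\dots,A^i_{n_s-1}]$, $B^i=[B^i_0,\dots,B^i_{n_s-1}]$ into consecutive blocks $v^i_p\in\mathbb{C}^s$, $A^i_p,B^i_p\in\mathbb{C}^{m\times s}$ (the last block being padded with zeros if $s\nmid n$). Let $(d^i_p)_{i\in[t],\,p\in[n_s]}$ be independent and identically distributed complex random variables whose common distribution is supported on the unit circle $\{z\in\mathbb{C}:|z|=1\}$ and has mean $0$. Let $D^i\in\mathbb{C}^{n\times n}$ be the diagonal matrix that multiplies the coordinates in the $p$-th block by $d^i_p$. With $\langle x,y\rangle=\sum_k\overline{x_k}\,y_k$, put $$\Psi(A,B,v)=\frac1t\sum_{i\in[t]}\sum_{p\in[n_s]}\langle A^i_pv^i_p,B^i_pv^i_p\rangle,\qquad \psi(A,B,v)=\sup_{i\in[t]}\sum_{p\neq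 q}\bigl|\langle A^i_pv^i_p,B^i_qv^i_q\rangle\bigr|^2 .$$ Then for every $\rho>0$, $$\mathbb{P}\left(\Bigl|\frac1t\sum_{i\in[t]}\langle A^iD^iv^i,B^iD^iv^i\rangle-\Psi(A,B,v)\Bigr|>\rho\right)\le 2\exp\left(-\kappa t\,\min\left(\frac{\rho^2}{\psi(A,B,v)},\frac{\rho}{\psi(A,B,v)^{1/2}}\right)\right),$$ where the right-hand side is read as $0$ if $\psi(A,B,v)=0$. -/

import Mathlib

open MeasureTheory ProbabilityTheory
open scoped Matrix

noncomputable section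

/-- The number `⌈n / s⌉` of consecutive blocks of length `s` that cover `n` coordinates. -/
def numBlocks (n s : ℕ) : ℕ := ⌈(n : ℚ) / (s : ℚ)⌉₊

theorem div_lt_numBlocks {n s j : ℕ} (hs : s ≠ 0) (hj : j < n) : j / s < numBlocks n s := by
  have hs' : (0 : ℚ) < (s : ℚ) := by exact_mod_cast Nat.pos_of_ne_zero hs
  rw [numBlocks, Nat.lt_ceil]
  calc ((j / s : ℕ) : ℚ) ≤ (j : ℚ) / (s : ℚ) := Nat.cast_div_le
    _ < (n : ℚ) / (s : ℚ) := by
      have h : (j : ℚ) < (n : ℚ) := by exact_mod_cast hj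
      gcongr

/-- The index of the block that contains the coordinate `j`. -/
def blockOf {n : ℕ} (s : ℕ) [NeZero s] (j : Fin n) : Fin (numBlocks n s) :=
  ⟨(j : ℕ) / s, div_lt_numBlocks (NeZero.ne s) j.isLt⟩

/-- The `p`-th block `v_p ∈ ℂ^s` of `v ∈ ℂ^n`; the last block is padded with zeros
if `s` does not divide `n`. -/
def vecBlock {n : ℕ} (s : ℕ) (v : Fin n → ℂ) (p : Fin (numBlocks n s)) : Fin s → ℂ :=
  fun a => if h : (p : ℕ) * s + (a : ℕ) < n then v ⟨(p : ℕ) * s + (a : ℕ), h⟩ else 0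

/-- The `p`-th column block `A_p ∈ ℂ^{m,s}` of `A ∈ ℂ^{m,n}`; the last block is padded with
zero columns if `s` does not divide `n`. -/
def matBlock {m n : ℕ} (s : ℕ) (A : Matrix (Fin m) (Fin n) ℂ) (p : Fin (numBlocks n s)) :
    Matrix (Fin m) (Fin s) ℂ :=
  Matrix.of fun k => vecBlock s (A k) p

/-- The block diagonal matrix in `ℂ^{n,n}` whose `p`-th diagonal block is `δ_p` times the
identity. -/
def dataMatrix {n : ℕ} (s : ℕ) [NeZero s] (δ : Fin (numBlocks n s) → ℂ) :
    Matrix (Fin n) (Fin n) ℂ :=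
  Matrix.diagonal fun j => δ (blockOf s j)

/-- The standard inner product of `ℂ^m`, conjugate linear in the first argument. -/
def innerC {m : ℕ} (x y : Fin m → ℂ) : ℂ := inner ℂ (WithLp.toLp 2 x) (WithLp.toLp 2 y)

/-- The interaction `⟨A_p v_p, B_q v_q⟩` of the blocks `p` and `q`. -/
def blockInner {m n : ℕ} (s : ℕ) (A B : Matrix (Fin m) (Fin n) ℂ) (v : Fin n → ℂ)
    (p q : Fin (numBlocks n s)) : ℂ :=
  innerC (matBlock s A p *ᵥ vecBlock s v p) (matBlock s B q *ᵥ vecBlock s v q)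

/-- `Ψ(A, B, v)`: the time average of the diagonal block interactions. -/
def diagPart {t m n : ℕ} (s : ℕ) (A B : Fin t → Matrix (Fin m) (Fin n) ℂ)
    (v : Fin t → Fin n → ℂ) : ℂ :=
  (1 / (t : ℂ)) * ∑ i, ∑ p, blockInner s (A i) (B i) (v i) p p

/-- `ψ(A, B, v)`: the maximum over the time slots of the total squared interaction of
distinct blocks. -/
def offDiagPart {t m n : ℕ} (s : ℕ) (A B : Fin t → Matrix (Fin m) (Fin n) ℂ)
    (v : Fin t → Fin n → ℂ) : ℝ :=
  ⨆ i, ∑ p, ∑ q with p ≠ q, ‖blockInner s (A i) (B i) (v i) p q‖ ^ 2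

/-- The time average `(1/t) ∑_i ⟨A^i D^i v^i, B^i D^i v^i⟩`, where `D^i` is the block diagonal
matrix of the data scalars `δ^i`. -/
def timeAverage {t m n : ℕ} (s : ℕ) [NeZero s] (A B : Fin t → Matrix (Fin m) (Fin n) ℂ)
    (v : Fin t → Fin n → ℂ) (δ : Fin t → Fin (numBlocks n s) → ℂ) : ℂ :=
  (1 / (t : ℂ)) * ∑ i, innerC (A i *ᵥ (dataMatrix s (δ i) *ᵥ v i))
    (B i *ᵥ (dataMatrix s (δ i) *ᵥ v i))

end

/-! Since `|d_p| = 1`, the diagonal terms of `⟨A D v, B D v⟩ = ∑ conj(d_p) d_q ⟨A_p v_p, B_q v_q⟩`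
are deterministic and sum to `Ψ` after time averaging. What remains is an average over `t`
independent slots of off-diagonal quadratic forms with centred bounded coefficients, and the claim
is a Bernstein bound for it. So it is enough to bound the exponential moment of the form in one slot
by `exp(32 l² ψ)` for `l² ψ ≤ 1/64`.

Decoupling does this. Up to a factor 4, the form is the average over subsets `I` of bilinear forms
coupling `I` with its complement (`sum_offDiag_eq_average`), so by convexity of `exp` one `I` at a
time suffices. With the variables in `I` frozen, the form is linear in the others, and Hoeffding's
lemma bounds its exponential moment by the exponential of a sum of squared linear forms in the
frozen variables. Such squares are made linear again by `exp(c Y²) = E exp(√(2c) Y g)` with `g`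
standard Gaussian, so Hoeffding applies once more. Only the Frobenius norm of the interactions
enters, which is why `ψ` alone governs both regimes of the tail.

The moments multiply over slots; Markov's inequality, with the parameter of
`exists_bernstein_parameter`, and a covering of the complex plane by half-planes finish the proof.
-/

/-- A finite family of independent, centred complex random variables bounded by `1`. -/
structure IsBoundedNoise {Ω ι : Type*} [MeasurableSpace Ω] (X : ι → Ω → ℂ) (P : Measure Ω) :
    Prop where
  aemeasurable : ∀ p, AEMeasurable (X p) P
  norm_le_one : ∀ p, ∀ᵐ ω ∂P, ‖X p ω‖ ≤ 1
  integral_eq_zero : ∀ p, ∫ ω, X p ω ∂P = 0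
  indep : iIndepFun X P

/-! ### Exponential moments of linear forms and of their squares -/

theorem lintegral_exp_mul_le_of_hasSubgaussianMGF {Ω : Type*} [MeasurableSpace Ω] {P : Measure Ω}
    {Y : Ω → ℝ} {c : NNReal} (h : HasSubgaussianMGF Y c P) (t : ℝ) :
    ∫⁻ ω, ENNReal.ofReal (Real.exp (t * Y ω)) ∂P ≤ ENNReal.ofReal (Real.exp (c * t ^ 2 / 2)) := by
  rw [← ofReal_integral_eq_lintegral_ofReal (h.integrable_exp_mul t)
    (ae_of_all _ fun ω => (Real.exp_pos _).le)]
  exact ENNReal.ofReal_le_ofReal (h.mgf_le t)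

theorem lintegral_exp_mul_gaussianReal (a : ℝ) :
    ∫⁻ g, ENNReal.ofReal (Real.exp (a * g)) ∂gaussianReal 0 1
      = ENNReal.ofReal (Real.exp (a ^ 2 / 2)) := by
  rw [← ofReal_integral_eq_lintegral_ofReal (integrable_exp_mul_gaussianReal a)
    (ae_of_all _ fun ω => (Real.exp_pos _).le)]
  have := congrFun (mgf_fun_id_gaussianReal (μ := 0) (v := 1)) a
  simp only [mgf] at this
  rw [this]
  simp

theorem sqrt_inv_one_sub_le_exp {x : ℝ} (h0 : 0 ≤ x) (h1 : x ≤ 1 / 2) :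
    Real.sqrt ((1 - x)⁻¹) ≤ Real.exp x := by
  rw [Real.sqrt_le_left (Real.exp_pos _).le, ← Real.exp_nat_mul]
  have h2 := Real.add_one_le_exp (((2 : ℕ) : ℝ) * x)
  refine le_trans ?_ h2
  rw [inv_le_iff_one_le_mul₀ (by linarith)]
  push_cast
  nlinarith

theorem lintegral_exp_mul_sq_gaussianReal_le {c : ℝ} (h0 : 0 ≤ c) (h1 : c ≤ 1 / 4) :
    ∫⁻ g, ENNReal.ofReal (Real.exp (c * g ^ 2)) ∂gaussianReal 0 1
      ≤ ENNReal.ofReal (Real.exp (2 * c)) := by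
  rw [gaussianReal_of_var_ne_zero 0 one_ne_zero,
    lintegral_withDensity_eq_lintegral_mul _ (measurable_gaussianPDF _ _) (by fun_prop)]
  have hb : 0 < 1 / 2 - c := by linarith
  have key : ∀ g : ℝ, (gaussianPDF 0 1 * fun g => ENNReal.ofReal (Real.exp (c * g ^ 2))) g
      = ENNReal.ofReal ((Real.sqrt (2 * Real.pi))⁻¹ * Real.exp (-(1 / 2 - c) * g ^ 2)) := by
    intro g
    simp only [Pi.mul_apply, gaussianPDF, gaussianPDFReal]
    rw [← ENNReal.ofReal_mul (by positivity), mul_assoc, ← Real.exp_add]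
    simp only [NNReal.coe_one, mul_one, sub_zero]
    congr 3
    ring
  simp_rw [key]
  rw [← ofReal_integral_eq_lintegral_ofReal ((integrable_exp_neg_mul_sq hb).const_mul _)
    (ae_of_all _ fun ω => by positivity), integral_const_mul, integral_gaussian]
  apply ENNReal.ofReal_le_ofReal
  rw [← Real.sqrt_inv, ← Real.sqrt_mul (by positivity)]
  refine le_trans (le_of_eq ?_) (sqrt_inv_one_sub_le_exp (x := 2 * c) (by linarith) (by linarith))
  congr 1
  have : 1 - 2 * c ≠ 0 := by linarith
  have := Real.pi_ne_zero
  have : 1 / 2 - c ≠ 0 := hb.ne'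
  field_simp

/-- The exponential square moment of a sub-Gaussian variable, by Gaussian linearization. -/
theorem lintegral_exp_mul_sq_le_of_hasSubgaussianMGF {Ω : Type*} [MeasurableSpace Ω]
    {P : Measure Ω} [IsProbabilityMeasure P] {Y : Ω → ℝ} {σ : NNReal}
    (h : HasSubgaussianMGF Y σ P) {c : ℝ} (h0 : 0 ≤ c) (h1 : c * σ ≤ 1 / 4) :
    ∫⁻ ω, ENNReal.ofReal (Real.exp (c * Y ω ^ 2)) ∂P
      ≤ ENNReal.ofReal (Real.exp (2 * (c * σ))) := by
  have hY := h.aemeasurable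
  calc ∫⁻ ω, ENNReal.ofReal (Real.exp (c * Y ω ^ 2)) ∂P
      = ∫⁻ ω, ∫⁻ g, ENNReal.ofReal (Real.exp (Real.sqrt (2 * c) * Y ω * g))
          ∂gaussianReal 0 1 ∂P := by
        refine lintegral_congr fun ω => ?_
        rw [lintegral_exp_mul_gaussianReal, mul_pow, Real.sq_sqrt (by positivity)]
        congr 2
        ring
    _ = ∫⁻ g, ∫⁻ ω, ENNReal.ofReal (Real.exp (Real.sqrt (2 * c) * Y ω * g))
          ∂P ∂gaussianReal 0 1 := by
        apply lintegral_lintegral_swap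
        have h1 : AEMeasurable (fun z : Ω × ℝ => Y z.1) (P.prod (gaussianReal 0 1)) := hY.comp_fst
        have h2 : AEMeasurable (fun z : Ω × ℝ => z.2) (P.prod (gaussianReal 0 1)) :=
          measurable_snd.aemeasurable
        exact ((h1.const_mul _).mul h2).exp.ennreal_ofReal
    _ ≤ ∫⁻ g, ENNReal.ofReal (Real.exp (c * σ * g ^ 2)) ∂gaussianReal 0 1 := by
        refine lintegral_mono fun g => ?_
        have := lintegral_exp_mul_le_of_hasSubgaussianMGF h (Real.sqrt (2 * c) * g)
        rw [mul_pow, Real.sq_sqrt (by positivity)] at this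
        convert this using 4 <;> ring_nf
    _ ≤ _ := lintegral_exp_mul_sq_gaussianReal_le (by positivity) h1

namespace IsBoundedNoise

variable {Ω ι : Type*} [MeasurableSpace Ω] {P : Measure Ω} {X : ι → Ω → ℂ}

/-- Hoeffding's lemma: each real part lies in `[-‖w q‖, ‖w q‖]`, so its variance proxy is `‖w q‖²`,
and proxies add under independence. -/
theorem hasSubgaussianMGF_re_sum (hX : IsBoundedNoise X P) (w : ι → ℂ) (S : Finset ι) :
    HasSubgaussianMGF (fun ω => (∑ q ∈ S, w q * X q ω).re) (∑ q ∈ S, ‖w q‖₊ ^ 2) P := by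
  have := hX.indep.isProbabilityMeasure
  have hind : iIndepFun (fun q ω => (w q * X q ω).re) P :=
    hX.indep.comp (fun q z => (w q * z).re) (fun q => by fun_prop)
  have hsub : ∀ q ∈ S, HasSubgaussianMGF (fun ω => (w q * X q ω).re) (‖w q‖₊ ^ 2) P := by
    intro q _
    have hint : Integrable (X q) P :=
      Integrable.of_bound (hX.aemeasurable q).aestronglyMeasurable 1 (hX.norm_le_one q)
    have h := hasSubgaussianMGF_of_mem_Icc_of_integral_eq_zero (μ := P)
      (X := fun ω => (w q * X q ω).re) (a := -‖w q‖) (b := ‖w q‖)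
      (Complex.measurable_re.comp_aemeasurable ((hX.aemeasurable q).const_mul _)) ?_ ?_
    · convert h using 2
      ext
      simp only [coe_nnnorm, NNReal.coe_div, NNReal.coe_ofNat, sub_neg_eq_add]
      rw [Real.norm_of_nonneg (by positivity)]
      ring
    · filter_upwards [hX.norm_le_one q] with ω hω
      rw [Set.mem_Icc, ← abs_le]
      refine (Complex.abs_re_le_norm _).trans ?_
      rw [norm_mul]
      exact mul_le_of_le_one_right (norm_nonneg _) hω
    · have h2 : ∫ ω, (w q * X q ω).re ∂P = (∫ ω, w q * X q ω ∂P).re :=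
        integral_re (𝕜 := ℂ) (hint.const_mul _)
      rw [h2, integral_const_mul, hX.integral_eq_zero]
      simp
  simpa using HasSubgaussianMGF.sum_of_iIndepFun hind hsub

theorem lintegral_exp_re_sum_le (hX : IsBoundedNoise X P) (w : ι → ℂ) (S : Finset ι) (t : ℝ) :
    ∫⁻ ω, ENNReal.ofReal (Real.exp (t * (∑ q ∈ S, w q * X q ω).re)) ∂P
      ≤ ENNReal.ofReal (Real.exp (t ^ 2 / 2 * ∑ q ∈ S, ‖w q‖ ^ 2)) := by
  convert lintegral_exp_mul_le_of_hasSubgaussianMGF (hX.hasSubgaussianMGF_re_sum w S) t using 3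
  push_cast
  ring

theorem lintegral_exp_norm_sum_sq_le (hX : IsBoundedNoise X P) (w : ι → ℂ) (S : Finset ι) {c : ℝ}
    (h0 : 0 ≤ c) (h1 : c * ∑ q ∈ S, ‖w q‖ ^ 2 ≤ 1 / 8) :
    ∫⁻ ω, ENNReal.ofReal (Real.exp (c * ‖∑ q ∈ S, w q * X q ω‖ ^ 2)) ∂P
      ≤ ENNReal.ofReal (Real.exp (4 * (c * ∑ q ∈ S, ‖w q‖ ^ 2))) := by
  have := hX.indep.isProbabilityMeasure
  have key : ∀ w : ι → ℂ, c * ∑ q ∈ S, ‖w q‖ ^ 2 ≤ 1 / 8 →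
      ∫⁻ ω, ENNReal.ofReal (Real.exp (2 * c * (∑ q ∈ S, w q * X q ω).re ^ 2)) ∂P
      ≤ ENNReal.ofReal (Real.exp (4 * (c * ∑ q ∈ S, ‖w q‖ ^ 2))) := by
    intro w hw
    convert lintegral_exp_mul_sq_le_of_hasSubgaussianMGF (hX.hasSubgaussianMGF_re_sum w S)
      (c := 2 * c) (by positivity) (by push_cast; linarith) using 3
    push_cast
    ring
  have hre := key w h1
  -- Multiplying the weights by `-i` turns the imaginary part into a real part without changing
  -- their norms.
  have him := key (fun q => -Complex.I * w q) (by simpa using h1)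
  have hint : ∀ ω, (∑ q ∈ S, -Complex.I * w q * X q ω).re = (∑ q ∈ S, w q * X q ω).im := by
    intro ω
    simp_rw [mul_assoc]
    rw [← Finset.mul_sum]
    simp
  simp only [hint, norm_mul, norm_neg, Complex.norm_I, one_mul] at him
  have hm : AEMeasurable (fun ω => ∑ q ∈ S, w q * X q ω) P :=
    Finset.aemeasurable_fun_sum _ fun q _ => (hX.aemeasurable q).const_mul _
  -- Convexity separates `re²` from `im²` without needing them independent, at the price of doubling
  -- `c`.
  have hpt : ∀ z : ℂ, Real.exp (c * ‖z‖ ^ 2)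
      ≤ 1 / 2 * Real.exp (2 * c * z.re ^ 2) + 1 / 2 * Real.exp (2 * c * z.im ^ 2) := by
    intro z
    obtain ⟨-, hconv⟩ := convexOn_exp
    have := hconv (Set.mem_univ (2 * c * z.re ^ 2)) (Set.mem_univ (2 * c * z.im ^ 2))
      (by norm_num : (0 : ℝ) ≤ 1 / 2) (by norm_num : (0 : ℝ) ≤ 1 / 2) (by norm_num)
    simp only [smul_eq_mul] at this
    refine le_trans (le_of_eq ?_) this
    rw [← Complex.normSq_eq_norm_sq, Complex.normSq_apply]
    congr 1
    ring
  set K := ENNReal.ofReal (Real.exp (4 * (c * ∑ q ∈ S, ‖w q‖ ^ 2))) with hK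
  calc _ ≤ ∫⁻ ω, (ENNReal.ofReal (1 / 2) *
            ENNReal.ofReal (Real.exp (2 * c * (∑ q ∈ S, w q * X q ω).re ^ 2))
          + ENNReal.ofReal (1 / 2) *
            ENNReal.ofReal (Real.exp (2 * c * (∑ q ∈ S, w q * X q ω).im ^ 2))) ∂P := by
        refine lintegral_mono fun ω => ?_
        rw [← ENNReal.ofReal_mul (by norm_num), ← ENNReal.ofReal_mul (by norm_num),
          ← ENNReal.ofReal_add (by positivity) (by positivity)]
        exact ENNReal.ofReal_le_ofReal (hpt _)
    _ ≤ ENNReal.ofReal (1 / 2) * K + ENNReal.ofReal (1 / 2) * K := by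
        rw [lintegral_add_left', lintegral_const_mul' _ _ ENNReal.ofReal_ne_top,
          lintegral_const_mul' _ _ ENNReal.ofReal_ne_top]
        · gcongr
        · exact (((Complex.measurable_re.comp_aemeasurable hm).pow_const 2).const_mul
            _).exp.ennreal_ofReal.const_mul _
    _ = K := by
        rw [← add_mul, ← ENNReal.ofReal_add (by norm_num) (by norm_num)]
        norm_num

end IsBoundedNoise

/-! ### Convexity, conditioning and decoupling -/

/-- Jensen's inequality for `exp`. It handles dependent summands, both for sums of squares and for
the average over subsets. -/
theorem lintegral_exp_sum_mul_le {Ω ι : Type*} [MeasurableSpace Ω] {P : Measure Ω} {S : Finset ι}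
    {w : ι → ℝ} {Y : ι → Ω → ℝ} (hw : ∀ i ∈ S, 0 ≤ w i) (hw1 : ∑ i ∈ S, w i = 1)
    (hY : ∀ i ∈ S, AEMeasurable (Y i) P) {K : ENNReal}
    (hK : ∀ i ∈ S, ∫⁻ ω, ENNReal.ofReal (Real.exp (Y i ω)) ∂P ≤ K) :
    ∫⁻ ω, ENNReal.ofReal (Real.exp (∑ i ∈ S, w i * Y i ω)) ∂P ≤ K := by
  calc _ ≤ ∫⁻ ω, ∑ i ∈ S, ENNReal.ofReal (w i) * ENNReal.ofReal (Real.exp (Y i ω)) ∂P := by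
        refine lintegral_mono fun ω => ?_
        have h := convexOn_exp.map_sum_le (t := S) (w := w) (p := fun i => Y i ω) hw hw1
          (fun _ _ => Set.mem_univ _)
        simp only [smul_eq_mul] at h
        refine (ENNReal.ofReal_le_ofReal h).trans (le_of_eq ?_)
        rw [ENNReal.ofReal_sum_of_nonneg fun i hi => mul_nonneg (hw i hi) (Real.exp_pos _).le]
        exact Finset.sum_congr rfl fun i hi => ENNReal.ofReal_mul (hw i hi)
    _ = ∑ i ∈ S, ENNReal.ofReal (w i) * ∫⁻ ω, ENNReal.ofReal (Real.exp (Y i ω)) ∂P := by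
        rw [lintegral_finsetSum' _ fun i hi => (hY i hi).exp.ennreal_ofReal.const_mul _]
        exact Finset.sum_congr rfl fun i _ => lintegral_const_mul' _ _ ENNReal.ofReal_ne_top
    _ ≤ ∑ i ∈ S, ENNReal.ofReal (w i) * K := by
        gcongr with i hi
        exact hK i hi
    _ = K := by
        rw [← Finset.sum_mul, ← ENNReal.ofReal_sum_of_nonneg hw, hw1]
        simp

theorem lintegral_comp_prodMk_le_of_indepFun {Ω α β : Type*} [MeasurableSpace Ω]
    [MeasurableSpace α] [MeasurableSpace β] {P : Measure Ω} [IsProbabilityMeasure P]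
    {U : Ω → α} {V : Ω → β} (h : IndepFun U V P) (hU : AEMeasurable U P) (hV : AEMeasurable V P)
    {F : α × β → ENNReal} (hF : Measurable F) {G : α → ENNReal} (hG : Measurable G)
    (hFG : ∀ u, ∫⁻ ω, F (u, V ω) ∂P ≤ G u) :
    ∫⁻ ω, F (U ω, V ω) ∂P ≤ ∫⁻ ω, G (U ω) ∂P := by
  have h2 := (indepFun_iff_map_prod_eq_prod_map_map hU hV).1 h
  have := Measure.isProbabilityMeasure_map hU
  have := Measure.isProbabilityMeasure_map hV
  rw [← lintegral_map' (f := F) hF.aemeasurable (hU.prodMk hV), h2,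
    lintegral_prod _ hF.aemeasurable, ← lintegral_map' hG.aemeasurable hU]
  refine lintegral_mono fun u => ?_
  rw [lintegral_map' (by fun_prop) hV]
  exact hFG u

theorem four_mul_card_filter_mem_notMem {ι : Type*} [Fintype ι] [DecidableEq ι] {p q : ι}
    (h : p ≠ q) :
    4 * (Finset.univ.filter fun I : Finset ι => p ∈ I ∧ q ∉ I).card = 2 ^ Fintype.card ι := by
  have h1 : (Finset.univ.filter fun I : Finset ι => p ∈ I ∧ q ∉ I)
      = Finset.Icc {p} (Finset.univ.erase q) := by
    ext I
    simp [Finset.subset_erase]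
  have h2 : 1 < Fintype.card ι := Fintype.one_lt_card_iff.2 ⟨p, q, h⟩
  rw [h1, Finset.card_Icc_finset (by simpa using h), Finset.card_erase_of_mem (Finset.mem_univ _),
    Finset.card_univ, Finset.card_singleton]
  obtain ⟨k, hk⟩ := Nat.exists_eq_add_of_lt h2
  rw [hk]
  simp only [show 1 + k + 1 - 1 - 1 = k by omega]
  ring

/-- A uniformly random subset contains `p` but not `q` with probability 1/4 if `p ≠ q`, and never if
`p = q`. -/
theorem sum_offDiag_eq_average {ι : Type*} [Fintype ι] [DecidableEq ι] (b : ι → ι → ℂ) :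
    ∑ p, ∑ q with p ≠ q, b p q = ∑ I : Finset ι,
      ((((2 : ℝ) ^ Fintype.card ι)⁻¹ : ℝ) : ℂ) * (4 * ∑ p ∈ I, ∑ q ∈ Iᶜ, b p q) := by
  have h1 : ∀ I : Finset ι, ∑ p ∈ I, ∑ q ∈ Iᶜ, b p q
      = ∑ p, ∑ q, if p ∈ I ∧ q ∉ I then b p q else 0 := by
    intro I
    calc ∑ p ∈ I, ∑ q ∈ Iᶜ, b p q = ∑ p, if p ∈ I then ∑ q ∈ Iᶜ, b p q else 0 := by simp
      _ = _ := by
        refine Finset.sum_congr rfl fun p _ => ?_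
        by_cases hp : p ∈ I
        · simp only [hp, if_true, true_and]
          rw [← Finset.sum_filter]
          exact Finset.sum_congr (by ext; simp) fun _ _ => rfl
        · simp [hp]
  rw [← Finset.mul_sum, ← Finset.mul_sum]
  simp_rw [h1]
  rw [Finset.sum_comm, Finset.mul_sum, Finset.mul_sum]
  refine Finset.sum_congr rfl fun p _ => ?_
  rw [Finset.sum_comm, Finset.mul_sum, Finset.mul_sum, Finset.sum_filter]
  refine Finset.sum_congr rfl fun q _ => ?_
  rw [← Finset.sum_filter, Finset.sum_const, nsmul_eq_mul]
  by_cases h : p = q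
  · subst h
    simp
  · have h2 : (4 : ℂ) * ((Finset.univ.filter fun I : Finset ι => p ∈ I ∧ q ∉ I).card : ℂ)
        = 2 ^ Fintype.card ι := by
      exact_mod_cast four_mul_card_filter_mem_notMem h
    rw [if_pos h, ← mul_assoc 4, h2, ← mul_assoc]
    push_cast
    rw [inv_mul_cancel₀ (pow_ne_zero _ two_ne_zero), one_mul]

namespace IsBoundedNoise

variable {Ω ι : Type*} [MeasurableSpace Ω] {P : Measure Ω} {X : ι → Ω → ℂ}

theorem aemeasurable_sum_mul (hX : IsBoundedNoise X P) (w : ι → ℂ) (S : Finset ι) :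
    AEMeasurable (fun ω => ∑ q ∈ S, w q * X q ω) P :=
  Finset.aemeasurable_fun_sum _ fun q _ => (hX.aemeasurable q).const_mul _

/-- The squares are dependent, so they are combined by Jensen with weights `σ q / F` proportional to
their variance proxies. The rescaled squares then all satisfy the same bound, depending on `c * F`
only. -/
theorem lintegral_exp_sum_norm_sum_sq_le (hX : IsBoundedNoise X P) (a : ι → ι → ℂ)
    (I J : Finset ι) {c : ℝ} (h0 : 0 ≤ c) (h1 : c * ∑ q ∈ J, ∑ p ∈ I, ‖a p q‖ ^ 2 ≤ 1 / 8) :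
    ∫⁻ ω, ENNReal.ofReal (Real.exp (c * ∑ q ∈ J, ‖∑ p ∈ I, a p q * X p ω‖ ^ 2)) ∂P
      ≤ ENNReal.ofReal (Real.exp (4 * (c * ∑ q ∈ J, ∑ p ∈ I, ‖a p q‖ ^ 2))) := by
  have := hX.indep.isProbabilityMeasure
  set σ : ι → ℝ := fun q => ∑ p ∈ I, ‖a p q‖ ^ 2 with hσ
  change c * ∑ q ∈ J, σ q ≤ 1 / 8 at h1
  change _ ≤ ENNReal.ofReal (Real.exp (4 * (c * ∑ q ∈ J, σ q)))
  set F : ℝ := ∑ q ∈ J, σ q with hF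
  have hσ0 : ∀ q, 0 ≤ σ q := fun q => Finset.sum_nonneg fun p _ => by positivity
  have hF0 : 0 ≤ F := Finset.sum_nonneg fun q _ => hσ0 q
  -- Indices with `σ q = 0` would lead to a division by zero, but their linear forms vanish
  -- identically.
  have hz : ∀ q, σ q = 0 → ∀ ω, ∑ p ∈ I, a p q * X p ω = 0 := by
    intro q hq ω
    refine Finset.sum_eq_zero fun p hp => ?_
    have := (Finset.sum_eq_zero_iff_of_nonneg (fun p _ => by positivity)).1 hq p hp
    simp [pow_eq_zero_iff] at this
    simp [this]
  rcases hF0.eq_or_lt with hF' | hF'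
  · have hall : ∀ q ∈ J, σ q = 0 :=
      (Finset.sum_eq_zero_iff_of_nonneg fun q _ => hσ0 q).1 hF'.symm
    have : ∀ ω, ∑ q ∈ J, ‖∑ p ∈ I, a p q * X p ω‖ ^ 2 = 0 := fun ω =>
      Finset.sum_eq_zero fun q hq => by simp [hz q (hall q hq) ω]
    simp [this, ← hF']
  · have heq : ∀ ω, c * ∑ q ∈ J, ‖∑ p ∈ I, a p q * X p ω‖ ^ 2
        = ∑ q ∈ J, σ q / F * (c * F / σ q * ‖∑ p ∈ I, a p q * X p ω‖ ^ 2) := by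
      intro ω
      rw [Finset.mul_sum]
      refine Finset.sum_congr rfl fun q _ => ?_
      by_cases hq : σ q = 0
      · simp [hz q hq ω]
      · field_simp
    simp_rw [heq]
    refine lintegral_exp_sum_mul_le (fun q _ => div_nonneg (hσ0 q) hF0) ?_ ?_ ?_
    · rw [← Finset.sum_div, div_self hF'.ne']
    · intro q _
      exact ((hX.aemeasurable_sum_mul (fun p => a p q) I).norm.pow_const 2).const_mul _
    · intro q _
      by_cases hq : σ q = 0
      · simp [hz q hq]
        positivity
      · have h := hX.lintegral_exp_norm_sum_sq_le (fun p => a p q) I (c := c * F / σ q)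
          (div_nonneg (by positivity) (hσ0 q))
        have h2 : c * F / σ q * σ q = c * F := div_mul_cancel₀ _ hq
        simp only [hσ] at h2 ⊢
        rw [h2] at h
        exact h h1

/-- Disjointness makes the two groups of variables independent. Integrating out `J` leaves squares
of linear forms in the variables of `I`. -/
theorem lintegral_exp_re_bilinear_le (hX : IsBoundedNoise X P) (M : ι → ι → ℂ)
    {I J : Finset ι} (hIJ : Disjoint I J) {t : ℝ}
    (ht : t ^ 2 * ∑ q ∈ J, ∑ p ∈ I, ‖M p q‖ ^ 2 ≤ 1 / 4) :
    ∫⁻ ω, ENNReal.ofReal (Real.exp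
        (t * (∑ p ∈ I, ∑ q ∈ J, starRingEnd ℂ (X p ω) * X q ω * M p q).re)) ∂P
      ≤ ENNReal.ofReal (Real.exp (2 * (t ^ 2 * ∑ q ∈ J, ∑ p ∈ I, ‖M p q‖ ^ 2))) := by
  have := hX.indep.isProbabilityMeasure
  have hind := hX.indep.indepFun_finset₀ I J hIJ hX.aemeasurable
  have hstep := lintegral_comp_prodMk_le_of_indepFun hind
    (aemeasurable_pi_lambda _ fun p => hX.aemeasurable p)
    (aemeasurable_pi_lambda _ fun p => hX.aemeasurable p)
    (F := fun z : (I → ℂ) × (J → ℂ) => ENNReal.ofReal (Real.exp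
      (t * (∑ q : J, (∑ p : I, starRingEnd ℂ (z.1 p) * M p q) * z.2 q).re)))
    (by
      have h1 : Continuous fun z : (I → ℂ) × (J → ℂ) =>
        ENNReal.ofReal (Real.exp
          (t * (∑ q : J, (∑ p : I, starRingEnd ℂ (z.1 p) * M p q) * z.2 q).re)) :=
        ENNReal.continuous_ofReal.comp (by fun_prop)
      exact h1.measurable)
    (G := fun u : I → ℂ => ENNReal.ofReal (Real.exp
      (t ^ 2 / 2 * ∑ q ∈ J, ‖∑ p : I, starRingEnd ℂ (u p) * M p q‖ ^ 2)))
    (by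
      have h1 : Continuous fun u : I → ℂ => ENNReal.ofReal (Real.exp
        (t ^ 2 / 2 * ∑ q ∈ J, ‖∑ p : I, starRingEnd ℂ (u p) * M p q‖ ^ 2)) :=
        ENNReal.continuous_ofReal.comp (by fun_prop)
      exact h1.measurable)
    (by
      intro u
      have h := hX.lintegral_exp_re_sum_le (fun q => ∑ p : I, starRingEnd ℂ (u p) * M p q) J t
      convert h using 7 with ω
      exact Finset.sum_coe_sort J
        (fun q => (∑ p : I, starRingEnd ℂ (u p) * M p q) * X q ω))
  have hL : ∀ ω, ∑ q : J, (∑ p : I, starRingEnd ℂ (X p ω) * M p q) * X q ω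
      = ∑ p ∈ I, ∑ q ∈ J, starRingEnd ℂ (X p ω) * X q ω * M p q := by
    intro ω
    rw [Finset.sum_coe_sort J (fun q => (∑ p : I, starRingEnd ℂ (X p ω) * M p q) * X q ω),
      Finset.sum_comm]
    refine Finset.sum_congr rfl fun q _ => ?_
    rw [Finset.sum_coe_sort I (fun p => starRingEnd ℂ (X p ω) * M p q), Finset.sum_mul]
    exact Finset.sum_congr rfl fun p _ => by ring
  have hR : ∀ ω q, ‖∑ p : I, starRingEnd ℂ (X p ω) * M p q‖
      = ‖∑ p ∈ I, starRingEnd ℂ (M p q) * X p ω‖ := by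
    intro ω q
    rw [Finset.sum_coe_sort I (fun p => starRingEnd ℂ (X p ω) * M p q), ← Complex.norm_conj,
      map_sum]
    congr 1
    refine Finset.sum_congr rfl fun p _ => ?_
    rw [map_mul, Complex.conj_conj, mul_comm]
  simp only [hL, hR] at hstep
  refine hstep.trans ?_
  have h := hX.lintegral_exp_sum_norm_sum_sq_le (fun p q => starRingEnd ℂ (M p q)) I J
    (c := t ^ 2 / 2) (by positivity) (by simp only [Complex.norm_conj]; linarith)
  simp only [Complex.norm_conj] at h
  exact h.trans (le_of_eq (by congr 2; ring))

end IsBoundedNoise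

namespace IsBoundedNoise

variable {Ω ι : Type*} [MeasurableSpace Ω] {P : Measure Ω} {X : ι → Ω → ℂ}

/-- The moment generating function of an off-diagonal quadratic form, by decoupling. -/
theorem lintegral_exp_re_offDiag_le [Fintype ι] [DecidableEq ι] (hX : IsBoundedNoise X P)
    (M : ι → ι → ℂ) {t F : ℝ} (hF : ∑ p, ∑ q with p ≠ q, ‖M p q‖ ^ 2 ≤ F)
    (ht : t ^ 2 * F ≤ 1 / 64) :
    ∫⁻ ω, ENNReal.ofReal (Real.exp
        (t * (∑ p, ∑ q with p ≠ q, starRingEnd ℂ (X p ω) * X q ω * M p q).re)) ∂P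
      ≤ ENNReal.ofReal (Real.exp (32 * (t ^ 2 * F))) := by
  have heq : ∀ ω, t * (∑ p, ∑ q with p ≠ q, starRingEnd ℂ (X p ω) * X q ω * M p q).re
      = ∑ I : Finset ι, ((2 : ℝ) ^ Fintype.card ι)⁻¹ *
        (4 * t * (∑ p ∈ I, ∑ q ∈ Iᶜ, starRingEnd ℂ (X p ω) * X q ω * M p q).re) := by
    intro ω
    rw [sum_offDiag_eq_average, Complex.re_sum, Finset.mul_sum]
    refine Finset.sum_congr rfl fun I _ => ?_
    rw [Complex.re_ofReal_mul, ← Complex.ofReal_ofNat, Complex.re_ofReal_mul]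
    ring
  simp_rw [heq]
  refine lintegral_exp_sum_mul_le (fun _ _ => by positivity) ?_ ?_ ?_
  · rw [Finset.sum_const, Finset.card_univ, Fintype.card_finset, nsmul_eq_mul]
    push_cast
    exact mul_inv_cancel₀ (by positivity)
  · intro I _
    refine (Complex.measurable_re.comp_aemeasurable ?_).const_mul _
    refine Finset.aemeasurable_fun_sum _ fun p _ => Finset.aemeasurable_fun_sum _ fun q _ => ?_
    exact ((Complex.continuous_conj.measurable.comp_aemeasurable (hX.aemeasurable p)).mul
      (hX.aemeasurable q)).mul_const _
  · intro I _
    have hFI : ∑ q ∈ Iᶜ, ∑ p ∈ I, ‖M p q‖ ^ 2 ≤ F := by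
      refine le_trans ?_ hF
      rw [Finset.sum_comm]
      calc ∑ p ∈ I, ∑ q ∈ Iᶜ, ‖M p q‖ ^ 2 ≤ ∑ p ∈ I, ∑ q with p ≠ q, ‖M p q‖ ^ 2 := by
            refine Finset.sum_le_sum fun p hp => ?_
            refine Finset.sum_le_sum_of_subset_of_nonneg ?_ fun _ _ _ => by positivity
            intro q hq
            simp only [Finset.mem_filter_univ]
            rintro rfl
            exact (Finset.mem_compl.1 hq) hp
        _ ≤ _ := Finset.sum_le_sum_of_subset_of_nonneg (Finset.subset_univ _)
            fun _ _ _ => Finset.sum_nonneg fun _ _ => by positivity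
    have hle := mul_le_mul_of_nonneg_left hFI (sq_nonneg t)
    -- The decoupling factor replaces `t` by `4 * t`, so the threshold `1/4` becomes `1/64` and the
    -- factor `2` becomes `32`.
    refine (hX.lintegral_exp_re_bilinear_le M (t := 4 * t)
      (disjoint_compl_right (a := I)) ?_).trans ?_
    · rw [mul_pow]
      linarith
    · refine ENNReal.ofReal_le_ofReal (Real.exp_le_exp.2 ?_)
      rw [mul_pow]
      linarith

end IsBoundedNoise

/-! ### Bernstein bound over independent slots -/

theorem lintegral_prod_comp_slots {Ω κ ι : Type*} [Fintype ι] [DecidableEq κ] [MeasurableSpace Ω]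
    {P : Measure Ω} {d : κ → ι → Ω → ℂ} (hd : ∀ i p, AEMeasurable (d i p) P)
    (hind : iIndepFun (fun ip : κ × ι => d ip.1 ip.2) P) {G : κ → (ι → ℂ) → ENNReal}
    (hG : ∀ i, Measurable (G i)) (S : Finset κ) :
    ∫⁻ ω, ∏ i ∈ S, G i (fun p => d i p ω) ∂P = ∏ i ∈ S, ∫⁻ ω, G i (fun p => d i p ω) ∂P := by
  classical
  have := hind.isProbabilityMeasure
  induction S using Finset.induction_on with
  | empty => simp
  | insert a S ha ih =>
    simp_rw [Finset.prod_insert ha]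
    rw [← ih]
    have hm : ∀ i, AEMeasurable (fun ω => G i (fun p => d i p ω)) P := fun i =>
      (hG i).comp_aemeasurable (aemeasurable_pi_lambda _ fun p => hd i p)
    refine lintegral_mul_eq_lintegral_mul_lintegral_of_indepFun'' (hm a)
      (Finset.aemeasurable_fun_prod _ fun i _ => hm i) ?_
    have hdisj : Disjoint (({a} : Finset κ) ×ˢ (Finset.univ : Finset ι))
        (S ×ˢ (Finset.univ : Finset ι)) := by
      rw [Finset.disjoint_left]
      rintro ⟨i, p⟩ h1 h2
      simp only [Finset.mem_product, Finset.mem_singleton] at h1 h2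
      exact ha (h1.1 ▸ h2.1)
    have h := hind.indepFun_finset₀ _ _ hdisj fun ip => hd ip.1 ip.2
    have h2 := h.comp
      (φ := fun u => G a fun p => u ⟨(a, p), by simp⟩)
      (ψ := fun v => ∏ i : S, G i fun p => v ⟨(i, p), by simp⟩)
      ((hG a).comp (measurable_pi_lambda _ fun p => measurable_pi_apply _))
      (Finset.measurable_fun_prod _ fun i _ =>
        (hG i).comp (measurable_pi_lambda _ fun p => measurable_pi_apply _))
    convert h2 using 1
    · rfl
    · ext ω
      exact (Finset.prod_coe_sort S fun i => G i fun p => d i p ω).symm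

theorem exists_bernstein_parameter {ψ r : ℝ} (hψ : 0 < ψ) (hr : 0 < r) :
    ∃ l : ℝ, 0 < l ∧ l ^ 2 * ψ ≤ 1 / 64 ∧
      32 * (l ^ 2 * ψ) - l * r ≤ -(1 / 128 * min (r ^ 2 / ψ) (r / Real.sqrt ψ)) := by
  obtain ⟨g, hg, rfl⟩ : ∃ g : ℝ, 0 < g ∧ ψ = g ^ 2 :=
    ⟨Real.sqrt ψ, Real.sqrt_pos.2 hψ, (Real.sq_sqrt hψ.le).symm⟩
  rw [Real.sqrt_sq hg.le]
  -- The first entry minimizes `32 l² ψ - l r`; the second is the largest `l` allowed by `l² ψ ≤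
  -- 1/64`. As `l ≤ r / (64 ψ)`, at least half of `l r` survives.
  set l := min (r / (64 * g ^ 2)) (1 / (8 * g)) with hl
  have hl0 : 0 < l := lt_min (by positivity) (by positivity)
  have h1 : l * (64 * g ^ 2) ≤ r := (le_div_iff₀ (by positivity)).1 (min_le_left _ _)
  have h2 : l * (8 * g) ≤ 1 := (le_div_iff₀ (by positivity)).1 (min_le_right _ _)
  have h3 : 1 / 128 * min (r ^ 2 / g ^ 2) (r / g) ≤ l * r / 2 := by
    rcases min_choice (r / (64 * g ^ 2)) (1 / (8 * g)) with h | h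
    · rw [hl, h]
      calc _ ≤ 1 / 128 * (r ^ 2 / g ^ 2) := by gcongr; exact min_le_left _ _
        _ = _ := by field_simp; norm_num
    · rw [hl, h]
      calc _ ≤ 1 / 128 * (r / g) := by gcongr; exact min_le_right _ _
        _ ≤ 1 / 16 * (r / g) := by gcongr; norm_num
        _ = _ := by field_simp; norm_num
  refine ⟨l, hl0, ?_, ?_⟩
  · nlinarith [mul_pos hl0 hg]
  · nlinarith

/-- A Bernstein bound for sums of independent off-diagonal quadratic forms. -/
theorem measureReal_sum_offDiag_gt_le {Ω κ ι : Type*} [Fintype κ] [Fintype ι] [DecidableEq ι]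
    [MeasurableSpace Ω] {P : Measure Ω} {d : κ → ι → Ω → ℂ}
    (hd : ∀ i, IsBoundedNoise (d i) P) (hind : iIndepFun (fun ip : κ × ι => d ip.1 ip.2) P)
    (M : κ → ι → ι → ℂ) {ψ r : ℝ} (hψ : 0 < ψ) (hr : 0 < r)
    (hM : ∀ i, ∑ p, ∑ q with p ≠ q, ‖M i p q‖ ^ 2 ≤ ψ) :
    P.real {ω | r * Fintype.card κ < (∑ i, ∑ p, ∑ q with p ≠ q,
        starRingEnd ℂ (d i p ω) * d i q ω * M i p q).re} ≤
      Real.exp (-(1 / 128 * Fintype.card κ * min (r ^ 2 / ψ) (r / Real.sqrt ψ))) := by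
  classical
  have := hind.isProbabilityMeasure
  obtain ⟨l, hl0, hl1, hl2⟩ := exists_bernstein_parameter hψ hr
  set Q : κ → (ι → ℂ) → ℂ := fun i x =>
    ∑ p, ∑ q with p ≠ q, starRingEnd ℂ (x p) * x q * M i p q with hQ
  have hQc : ∀ i, Continuous (Q i) := fun i => by fun_prop
  set G : κ → (ι → ℂ) → ENNReal := fun i x => ENNReal.ofReal (Real.exp (l * (Q i x).re)) with hG
  have hGm : ∀ i, Measurable (G i) := fun i => by
    have : Continuous (G i) := ENNReal.continuous_ofReal.comp (by fun_prop)
    exact this.measurable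
  have hprod := lintegral_prod_comp_slots (fun i => (hd i).aemeasurable) hind hGm Finset.univ
  have hbound : ∀ i, ∫⁻ ω, G i (fun p => d i p ω) ∂P
      ≤ ENNReal.ofReal (Real.exp (32 * (l ^ 2 * ψ))) := fun i =>
    (hd i).lintegral_exp_re_offDiag_le (M i) (hM i) hl1
  have hGprod : ∀ ω, ∏ i, G i (fun p => d i p ω)
      = ENNReal.ofReal (Real.exp (l * (∑ i, Q i fun p => d i p ω).re)) := by
    intro ω
    rw [Complex.re_sum, Finset.mul_sum, Real.exp_sum,
      ENNReal.ofReal_prod_of_nonneg fun _ _ => (Real.exp_pos _).le]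
  have hmeas : AEMeasurable (fun ω => ∏ i, G i (fun p => d i p ω)) P :=
    Finset.aemeasurable_fun_prod _ fun i _ =>
      (hGm i).comp_aemeasurable (aemeasurable_pi_lambda _ fun p => (hd i).aemeasurable p)
  set N := Fintype.card κ with hN
  have hmarkov := mul_meas_ge_le_lintegral₀ hmeas (ENNReal.ofReal (Real.exp (l * (r * N))))
  rw [hprod] at hmarkov
  have hmarkov2 := hmarkov.trans (Finset.prod_le_pow_card _ _ _ fun i _ => hbound i)
  rw [Finset.card_univ, ← hN, ← ENNReal.ofReal_pow (Real.exp_pos _).le, ← Real.exp_nat_mul]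
    at hmarkov2
  have hsub : {ω | r * N < (∑ i, Q i fun p => d i p ω).re} ⊆
      {ω | ENNReal.ofReal (Real.exp (l * (r * N))) ≤ ∏ i, G i (fun p => d i p ω)} := by
    intro ω hω
    rw [Set.mem_ofPred_eq] at hω ⊢
    rw [hGprod]
    gcongr
  refine (measureReal_mono hsub).trans ?_
  have hreal := ENNReal.toReal_mono ENNReal.ofReal_ne_top hmarkov2
  rw [ENNReal.toReal_mul, ENNReal.toReal_ofReal (Real.exp_pos _).le,
    ENNReal.toReal_ofReal (Real.exp_pos _).le, mul_comm, ← le_div_iff₀ (Real.exp_pos _),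
    ← Real.exp_sub] at hreal
  refine hreal.trans (Real.exp_le_exp.2 ?_)
  have := mul_le_mul_of_nonneg_left hl2 (Nat.cast_nonneg (α := ℝ) N)
  linarith

theorem half_lt_of_lt_norm {z : ℂ} {R : ℝ} (h : R < ‖z‖) :
    ∃ k : Fin 4, R / 2 < (Complex.I ^ (k : ℕ) * z).re := by
  have h1 := Complex.norm_le_abs_re_add_abs_im z
  have h2 : R / 2 < |z.re| ∨ R / 2 < |z.im| := by
    by_contra! hc
    linarith
  rcases h2 with h2 | h2 <;> rcases lt_abs.1 h2 with h3 | h3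
  · exact ⟨0, by simpa using h3⟩
  · exact ⟨2, by simpa using h3⟩
  · exact ⟨3, by simpa [Complex.I_pow_three] using h3⟩
  · exact ⟨1, by simpa using h3⟩

/-- The two-sided complex form of `measureReal_sum_offDiag_gt_le`. -/
theorem measureReal_norm_sum_offDiag_gt_le {Ω κ ι : Type*} [Fintype κ] [Fintype ι]
    [DecidableEq ι] [MeasurableSpace Ω] {P : Measure Ω} {d : κ → ι → Ω → ℂ}
    (hd : ∀ i, IsBoundedNoise (d i) P) (hind : iIndepFun (fun ip : κ × ι => d ip.1 ip.2) P)
    (M : κ → ι → ι → ℂ) {ψ r : ℝ} (hψ : 0 < ψ) (hr : 0 < r)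
    (hM : ∀ i, ∑ p, ∑ q with p ≠ q, ‖M i p q‖ ^ 2 ≤ ψ) :
    P.real {ω | r * Fintype.card κ < ‖∑ i, ∑ p, ∑ q with p ≠ q,
        starRingEnd ℂ (d i p ω) * d i q ω * M i p q‖} ≤
      2 * Real.exp (-(1 / 1024 * Fintype.card κ * min (r ^ 2 / ψ) (r / Real.sqrt ψ))) := by
  have := hind.isProbabilityMeasure
  set y := 1 / 1024 * Fintype.card κ * min (r ^ 2 / ψ) (r / Real.sqrt ψ) with hy
  have hsub : {ω | r * Fintype.card κ < ‖∑ i, ∑ p, ∑ q with p ≠ q,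
        starRingEnd ℂ (d i p ω) * d i q ω * M i p q‖} ⊆
      ⋃ k : Fin 4, {ω | r / 2 * Fintype.card κ < (∑ i, ∑ p, ∑ q with p ≠ q,
        starRingEnd ℂ (d i p ω) * d i q ω * (Complex.I ^ (k : ℕ) * M i p q)).re} := by
    intro ω hω
    obtain ⟨k, hk⟩ := half_lt_of_lt_norm (Set.mem_ofPred_eq ▸ hω)
    refine Set.mem_iUnion.2 ⟨k, ?_⟩
    rw [Set.mem_ofPred_eq]
    simp only [Finset.mul_sum] at hk
    simp only [mul_left_comm _ (Complex.I ^ (k : ℕ))]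
    convert hk using 1
    ring
  have htail : ∀ k : Fin 4, P.real {ω | r / 2 * Fintype.card κ < (∑ i, ∑ p, ∑ q with p ≠ q,
        starRingEnd ℂ (d i p ω) * d i q ω * (Complex.I ^ (k : ℕ) * M i p q)).re}
      ≤ Real.exp (-y) ^ 2 := by
    intro k
    refine (measureReal_sum_offDiag_gt_le hd hind (fun i p q => Complex.I ^ (k : ℕ) * M i p q) hψ
      (half_pos hr) (by simpa using hM)).trans ?_
    rw [← Real.exp_nat_mul]
    refine Real.exp_le_exp.2 ?_
    -- Halving `r` costs at most a factor 4 in the minimum; a further factor 2 pays for the square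
    -- of `exp (-y)`, whence `1024 = 128 * 4 * 2`.
    have hmin : 1 / 4 * min (r ^ 2 / ψ) (r / Real.sqrt ψ)
        ≤ min ((r / 2) ^ 2 / ψ) (r / 2 / Real.sqrt ψ) := by
      have hs := Real.sqrt_pos.2 hψ
      refine le_min ?_ ?_
      · calc _ ≤ 1 / 4 * (r ^ 2 / ψ) := by gcongr; exact min_le_left _ _
          _ = _ := by ring
      · calc _ ≤ 1 / 4 * (r / Real.sqrt ψ) := by gcongr; exact min_le_right _ _
          _ ≤ 1 / 2 * (r / Real.sqrt ψ) := by gcongr; norm_num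
          _ = _ := by ring
    have := mul_le_mul_of_nonneg_left hmin (Nat.cast_nonneg (α := ℝ) (Fintype.card κ))
    push_cast
    rw [hy]
    linarith
  have hsum := (measureReal_mono (μ := P) hsub).trans (measureReal_iUnion_fintype_le _)
  have h4 := hsum.trans (Finset.sum_le_sum fun k _ => htail k)
  simp only [Finset.sum_const, Finset.card_univ, Fintype.card_fin, nsmul_eq_mul] at h4
  -- The union bound gives `4x²` with `x = exp (-y)`. The prefactor 2 comes from `min (4x²) 1 ≤ 2x`.
  rcases le_total (Real.exp (-y)) (1 / 2) with h | h
  · refine h4.trans ?_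
    push_cast
    nlinarith [Real.exp_pos (-y)]
  · exact measureReal_le_one.trans (by linarith)

/-! ### Block expansion of the time average -/

/-- Division with remainder by `s` places each coordinate in exactly one block position; the padded
positions contribute zero. -/
theorem sum_blocks {n : ℕ} (s : ℕ) [NeZero s] (f : Fin n → ℂ) :
    ∑ p : Fin (numBlocks n s), ∑ a : Fin s,
      (if h : (p : ℕ) * s + (a : ℕ) < n then f ⟨(p : ℕ) * s + (a : ℕ), h⟩ else 0) = ∑ j, f j := by
  have hs := NeZero.pos s
  have h1 : ∀ (p : Fin (numBlocks n s)) (a : Fin s),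
      (if h : (p : ℕ) * s + (a : ℕ) < n then f ⟨(p : ℕ) * s + (a : ℕ), h⟩ else 0)
        = ∑ j : Fin n, if (j : ℕ) = p * s + a then f j else 0 := by
    intro p a
    split_ifs with h
    · rw [Finset.sum_eq_single ⟨(p : ℕ) * s + (a : ℕ), h⟩]
      · simp
      · intro j _ hj
        rw [if_neg fun hc => hj (Fin.ext hc)]
      · simp
    · refine (Finset.sum_eq_zero fun j _ => if_neg ?_).symm
      have := j.isLt
      omega
  simp_rw [h1]
  have h2 : ∀ p : Fin (numBlocks n s),
      (∑ a : Fin s, ∑ j : Fin n, if (j : ℕ) = p * s + a then f j else 0)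
        = ∑ j : Fin n, ∑ a : Fin s, if (j : ℕ) = p * s + a then f j else 0 :=
    fun p => Finset.sum_comm
  simp_rw [h2]
  rw [Finset.sum_comm]
  refine Finset.sum_congr rfl fun j _ => ?_
  rw [Finset.sum_eq_single (blockOf s j), Finset.sum_eq_single ⟨j % s, Nat.mod_lt _ hs⟩]
  · rw [if_pos]
    exact (Nat.div_add_mod' _ _).symm
  · intro a _ ha
    rw [if_neg]
    intro hc
    refine ha (Fin.ext ?_)
    simp [hc, Nat.mod_eq_of_lt a.isLt]
  · simp
  · intro p _ hp
    refine Finset.sum_eq_zero fun a _ => if_neg fun hc => hp (Fin.ext ?_)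
    change (p : ℕ) = (j : ℕ) / s
    rw [hc, mul_comm, Nat.mul_add_div hs, Nat.div_eq_of_lt a.isLt, add_zero]
  · simp

theorem blockOf_mk {n s : ℕ} [NeZero s] (p : Fin (numBlocks n s)) (a : Fin s)
    (h : (p : ℕ) * s + (a : ℕ) < n) : blockOf s ⟨(p : ℕ) * s + (a : ℕ), h⟩ = p := by
  refine Fin.ext ?_
  change ((p : ℕ) * s + a) / s = p
  rw [mul_comm, Nat.mul_add_div (NeZero.pos s), Nat.div_eq_of_lt a.isLt, add_zero]

theorem mulVec_dataMatrix_mulVec {m n : ℕ} (s : ℕ) [NeZero s] (A : Matrix (Fin m) (Fin n) ℂ)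
    (v : Fin n → ℂ) (δ : Fin (numBlocks n s) → ℂ) :
    A *ᵥ (dataMatrix s δ *ᵥ v) = ∑ p, δ p • (matBlock s A p *ᵥ vecBlock s v p) := by
  have hdiag : dataMatrix s δ *ᵥ v = fun j => δ (blockOf s j) * v j :=
    funext fun j => Matrix.mulVec_diagonal _ _ _
  rw [hdiag]
  ext k
  simp only [Matrix.mulVec, dotProduct, Finset.sum_apply,
    Pi.smul_apply, smul_eq_mul, matBlock, Matrix.of_apply]
  rw [← sum_blocks s]
  refine Finset.sum_congr rfl fun p _ => ?_
  rw [Finset.mul_sum]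
  refine Finset.sum_congr rfl fun a _ => ?_
  simp only [vecBlock]
  split_ifs with h
  · rw [blockOf_mk]
    ring
  · simp

theorem innerC_mulVec_dataMatrix {m n : ℕ} (s : ℕ) [NeZero s] (A B : Matrix (Fin m) (Fin n) ℂ)
    (v : Fin n → ℂ) (δ : Fin (numBlocks n s) → ℂ) :
    innerC (A *ᵥ (dataMatrix s δ *ᵥ v)) (B *ᵥ (dataMatrix s δ *ᵥ v))
      = ∑ p, ∑ q, starRingEnd ℂ (δ p) * δ q * blockInner s A B v p q := by
  rw [mulVec_dataMatrix_mulVec, mulVec_dataMatrix_mulVec]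
  simp only [innerC, blockInner, WithLp.toLp_sum, WithLp.toLp_smul, sum_inner, inner_sum,
    inner_smul_left, inner_smul_right, Finset.mul_sum]
  rw [Finset.sum_comm]
  refine Finset.sum_congr rfl fun p _ => Finset.sum_congr rfl fun q _ => ?_
  ring

theorem timeAverage_sub_diagPart {t m n : ℕ} (s : ℕ) [NeZero s]
    (A B : Fin t → Matrix (Fin m) (Fin n) ℂ) (v : Fin t → Fin n → ℂ)
    (δ : Fin t → Fin (numBlocks n s) → ℂ) (hδ : ∀ i p, ‖δ i p‖ = 1) :
    timeAverage s A B v δ - diagPart s A B v = (1 / (t : ℂ)) * ∑ i, ∑ p, ∑ q with p ≠ q,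
      starRingEnd ℂ (δ i p) * δ i q * blockInner s (A i) (B i) (v i) p q := by
  rw [timeAverage, diagPart, ← mul_sub, ← Finset.sum_sub_distrib]
  congr 1
  refine Finset.sum_congr rfl fun i _ => ?_
  rw [innerC_mulVec_dataMatrix, ← Finset.sum_sub_distrib]
  refine Finset.sum_congr rfl fun p _ => ?_
  rw [← Finset.sum_filter_add_sum_filter_not Finset.univ (fun q => p ≠ q), add_sub_assoc,
    add_eq_left, sub_eq_zero]
  have h : (Finset.univ.filter fun q => ¬p ≠ q) = {p} := by
    ext q
    simp [eq_comm]
  -- Modulus exactly 1 is needed here, to make the diagonal deterministic; the tail bound only needs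
  -- modulus at most 1.
  rw [h, Finset.sum_singleton, Complex.conj_mul', hδ]
  simp

theorem sum_norm_sq_le_offDiagPart {t m n : ℕ} (s : ℕ)
    (A B : Fin t → Matrix (Fin m) (Fin n) ℂ) (v : Fin t → Fin n → ℂ) (i : Fin t) :
    ∑ p, ∑ q with p ≠ q, ‖blockInner s (A i) (B i) (v i) p q‖ ^ 2 ≤ offDiagPart s A B v :=
  le_ciSup (f := fun i => ∑ p, ∑ q with p ≠ q, ‖blockInner s (A i) (B i) (v i) p q‖ ^ 2)
    (Set.finite_range _).bddAbove i

/-! ### The concentration inequality -/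

theorem mainTheorem6 :
    ∃ κ : ℝ, 0 < κ ∧
      ∀ (t m n s : ℕ) [NeZero t] [NeZero s]
        (A B : Fin t → Matrix (Fin m) (Fin n) ℂ) (v : Fin t → Fin n → ℂ)
        (Ω : Type*) [MeasurableSpace Ω] (P : Measure Ω) [IsProbabilityMeasure P]
        (ν : Measure ℂ) [IsProbabilityMeasure ν]
        (d : Fin t → Fin (numBlocks n s) → Ω → ℂ),
        (∀ᵐ z ∂ν, ‖z‖ = 1) →
        ∫ z, z ∂ν = 0 →
        (∀ i p, HasLaw (d i p) ν P) →
        iIndepFun (fun ip : Fin t × Fin (numBlocks n s) => d ip.1 ip.2) P →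
        ∀ ρ : ℝ, 0 < ρ →
          (0 < offDiagPart s A B v →
            P.real {ω | ρ < ‖timeAverage s A B v (fun i p => d i p ω) - diagPart s A B v‖} ≤
              2 * Real.exp (-κ * t * min (ρ ^ 2 / offDiagPart s A B v)
                (ρ / Real.sqrt (offDiagPart s A B v)))) ∧
          (offDiagPart s A B v = 0 →
            P.real {ω | ρ < ‖timeAverage s A B v (fun i p => d i p ω) - diagPart s A B v‖} = 0) := by
  refine ⟨1 / 1024, by norm_num, ?_⟩
  intro t m n s _ _ A B v Ω _ P _ ν _ d hν hmean hlaw hind ρ hρ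
  have hnorm : ∀ᵐ ω ∂P, ∀ i p, ‖d i p ω‖ = 1 := by
    rw [ae_all_iff]
    intro i
    rw [ae_all_iff]
    intro p
    have h := hlaw i p
    rw [← h.map_eq] at hν
    exact ae_of_ae_map h.aemeasurable hν
  have hd : ∀ i, IsBoundedNoise (d i) P := fun i =>
    { aemeasurable := fun p => (hlaw i p).aemeasurable
      norm_le_one := fun p => by
        filter_upwards [hnorm] with ω hω using (hω i p).le
      integral_eq_zero := fun p => (hlaw i p).integral_eq.trans hmean
      indep := hind.precomp (g := fun p => (i, p)) fun _ _ h => (Prod.mk.inj h).2 }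
  have ht : (0 : ℝ) < t := Nat.cast_pos.2 (NeZero.pos t)
  have hM := sum_norm_sq_le_offDiagPart s A B v
  -- The variables are unimodular only almost surely, so the two events agree up to a null set.
  have hae : {ω | ρ < ‖timeAverage s A B v (fun i p => d i p ω) - diagPart s A B v‖} =ᵐ[P]
      {ω | ρ * Fintype.card (Fin t) < ‖∑ i, ∑ p, ∑ q with p ≠ q, starRingEnd ℂ (d i p ω) * d i q ω
        * blockInner s (A i) (B i) (v i) p q‖} := by
    filter_upwards [hnorm] with ω hω
    refine propext ?_
    change ρ < _ ↔ _ < ‖_‖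
    rw [timeAverage_sub_diagPart s A B v _ hω, norm_mul, norm_div, norm_one, Complex.norm_natCast,
      one_div_mul_eq_div, lt_div_iff₀ ht, Fintype.card_fin]
  rw [measureReal_congr hae]
  refine ⟨fun hψ => ?_, fun hψ => ?_⟩
  · refine (measureReal_norm_sum_offDiag_gt_le hd hind _ hψ hρ hM).trans (le_of_eq ?_)
    rw [Fintype.card_fin]
    ring_nf
  -- If `ψ = 0`, every off-diagonal interaction vanishes, so the deviation event, rewritten through
  -- the off-diagonal sum, is empty.
  · have hz : ∀ i p, ∀ q ∈ Finset.univ.filter (fun q => p ≠ q),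
        blockInner s (A i) (B i) (v i) p q = 0 := by
      intro i p q hq
      have h0 := (hM i).trans hψ.le
      have h1 : ‖blockInner s (A i) (B i) (v i) p q‖ ^ 2 ≤ 0 :=
        ((Finset.single_le_sum (fun q _ => by positivity) hq).trans
          (Finset.single_le_sum (f := fun p => ∑ q with p ≠ q,
            ‖blockInner s (A i) (B i) (v i) p q‖ ^ 2)
            (fun p _ => Finset.sum_nonneg fun q _ => by positivity) (Finset.mem_univ p))).trans h0
      exact norm_eq_zero.1 (pow_eq_zero_iff two_ne_zero |>.1 (le_antisymm h1 (by positivity)))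
    have hs : ∀ ω, ∑ i, ∑ p, ∑ q with p ≠ q, starRingEnd ℂ (d i p ω) * d i q ω
        * blockInner s (A i) (B i) (v i) p q = 0 := fun ω =>
      Finset.sum_eq_zero fun i _ => Finset.sum_eq_zero fun p _ =>
        Finset.sum_eq_zero fun q hq => by rw [hz i p q hq, mul_zero]
    simp only [hs, norm_zero]
    have : ¬ ρ * (Fintype.card (Fin t) : ℝ) < 0 := not_lt.2 (by positivity)
    simp only [this, Set.ofPred_false, measureReal_empty]
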